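/- **Conventions.** For a topological space $X$, $\dim(X)\in\{-1,0,1,2,\dots\}\cup\{\infty\}$ is the covering dimension: the least integer $d\ge -1$ such that every finite open cover of $X$ has an open refinement (again covering $X$) with each point of $X$ in at most $d+1$ of its members, and $\dim(X)=\infty$ if there is no such $d$ (so $\dim(\varnothing)=-1$). For a C*-algebra $B$ and $a,b\in B_+$, write $a\precsim b$ (Cuntz subequivalence) if there are $v_k\in B$ with $v_k b v_k^*\to a$ in norm. A unital C*-algebra $A$ has $r$-comparison, for a real $r\ge 0$, if for all $n$ and all $a,b\in M_n(A)_+$, whenever $d_\tau(a)+r<d_\tau(b)$ for every normalized quasitrace $\tau$ on $A$ (that is, $2$-quasitrace with $\tau(1)=1$, extended canonically to all $M_n(A)$), then $a\precsim b$ in $M_n(A)$; here $d_\tau(a)=\lim_{k\to\infty}\tau(a^{1/k})$. The radius of comparison is $\operatorname{rc}(A)=\inf\{r\ge 0 : A \text{ has } r\text{-comparison}\}\in[0,\infty]$, with $\inf\varnothing=\infty$. **Theorem.** Let $X$ be a compact Hausdorff space, and let $C(X)$ be the C*-algebra of continuous complex-valued functions on $X$. 1. If $\dim(X)=\infty$,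 then $\operatorname{rc}(C(X))=\infty$. 2. If $\dim(X)<\infty$ and $\dim(X)\equiv 0 \pmod 4$, then $\operatorname{rc}(C(X))\ge\frac12(\dim(X)-4)$. 3. If $\dim(X)<\infty$ and $\dim(X)\equiv 1 \pmod 4$, then $\operatorname{rc}(C(X))\ge\frac12(\dim(X)-5)$. 4. If $\dim(X)<\infty$ and $\dim(X)\equiv 2 \pmod 4$, then $\operatorname{rc}(C(X))\ge\frac12(\dim(X)-6)$. 5. If $\dim(X)<\infty$ and $\dim(X)\equiv 3 \pmod 4$, then $\operatorname{rc}(C(X))\ge\frac12(\dim(X)-7)$. -/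

import Mathlib

open Filter Topology
open scoped ComplexOrder NNReal ENNReal

noncomputable section

/-! ### Covering dimension -/

/-- Every finite open cover of `X` has an open refinement covering `X` such that each point lies
in at most `m` members of the refinement; that is, an open refinement of order at most `m - 1`. -/
def HasOpenRefinements (X : Type*) [TopologicalSpace X] (m : ℕ) : Prop :=
  ∀ U : Set (Set X), U.Finite → (∀ u ∈ U, IsOpen u) → ⋃₀ U = Set.univ →
    ∃ V : Set (Set X), (∀ v ∈ V, IsOpen v) ∧ ⋃₀ V = Set.univ ∧ (∀ v ∈ V, ∃ u ∈ U, v ⊆ u) ∧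
      ∀ x : X, {v | v ∈ V ∧ x ∈ v}.encard ≤ m

/-- The covering dimension of `X`: the least integer `d ≥ -1` such that every finite open cover
has an open refinement of order at most `d` (each point in at most `d + 1` members), and `⊤` if
there is no such integer. The empty space has dimension `-1`. -/
def coveringDim (X : Type*) [TopologicalSpace X] : EReal :=
  ⨅ (m : ℕ) (_ : HasOpenRefinements X m), (((m : ℝ) - 1 : ℝ) : EReal)

/-! ### Cuntz comparison, quasitraces and the radius of comparison -/

/-- Cuntz subequivalence `a ≾ b` in a C*-algebra: `a` is a norm limit of elements
`v b v*`. -/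
def CuntzLE {B : Type*} [NonUnitalCStarAlgebra B] (a b : B) : Prop :=
  ∃ v : ℕ → B, Tendsto (fun k => v k * b * star (v k)) atTop (𝓝 a)

/-- The axioms of a quasitrace at a single matrix level: `τ (x* x) = τ (x x*) ≥ 0`, `τ` is linear
on commutative *-subalgebras, and `τ (a + i b) = τ a + i τ b` for self-adjoint `a, b`. -/
structure IsQuasitrace {B : Type*} [CStarAlgebra B] (τ : B → ℂ) : Prop where
  nonneg : ∀ x : B, 0 ≤ τ (star x * x)
  tracial : ∀ x : B, τ (star x * x) = τ (x * star x)
  linear_of_commutative : ∀ S : NonUnitalStarSubalgebra ℂ B,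
    (∀ x ∈ S, ∀ y ∈ S, x * y = y * x) → IsLinearMap ℂ (fun x : S => τ x)
  add_I_smul : ∀ a b : B, IsSelfAdjoint a → IsSelfAdjoint b →
    τ (a + Complex.I • b) = τ a + Complex.I * τ b

/-- A positive power of an element of a C*-algebra, by continuous functional calculus. -/
def posPow {B : Type*} [CStarAlgebra B] [PartialOrder B] [StarOrderedRing B] (b : B) (r : ℝ) : B :=
  b ^ r

variable {A : Type*} [CStarAlgebra A] [PartialOrder A] [StarOrderedRing A]

variable (A) in
/-- A normalized (2-)quasitrace on the unital C*-algebra `A`, given together with its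
extensions to all matrix algebras `M_n(A)`. These are compatible with the embeddings of `M_n(A)`
as the upper left corner of `M_(n+1)(A)`, and the value at the unit of `A = M_1(A)` is `1`. -/
structure NormalizedQuasitrace where
  toFun : ∀ n : ℕ, CStarMatrix (Fin n) (Fin n) A → ℂ
  isQuasitrace : ∀ n : ℕ, IsQuasitrace (toFun n)
  corner : ∀ (n : ℕ) (a : CStarMatrix (Fin (n + 1)) (Fin (n + 1)) A),
    (∀ i, a i (Fin.last n) = 0) → (∀ j, a (Fin.last n) j = 0) →
      toFun (n + 1) a =
        toFun n (CStarMatrix.ofMatrix fun i j : Fin n => a i.castSucc j.castSucc)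
  map_one : toFun 1 1 = 1

/-- The dimension function `d_τ(a) = lim_k τ(a^(1/k))` of a quasitrace, for a positive
`a ∈ M_n(A)`. The sequence converges for every positive `a`, so the upper limit is the limit. -/
def NormalizedQuasitrace.dim (τ : NormalizedQuasitrace A) {n : ℕ}
    (a : CStarMatrix (Fin n) (Fin n) A) : ℝ≥0∞ :=
  limsup (fun k : ℕ => ENNReal.ofReal (τ.toFun n (posPow a (1 / ((k : ℝ) + 1)))).re) atTop

variable (A) in
/-- `A` has `r`-comparison: if positive `a, b ∈ M_n(A)` satisfy `d_τ(a) + r < d_τ(b)` for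
every normalized quasitrace `τ` on `A`, then `a ≾ b`. (Two elements of different matrix
algebras are compared by padding the smaller one with zeros.) -/
def HasRComparison (r : ℝ≥0) : Prop :=
  ∀ (n : ℕ) (a b : CStarMatrix (Fin n) (Fin n) A), 0 ≤ a → 0 ≤ b →
    (∀ τ : NormalizedQuasitrace A, τ.dim a + (r : ℝ≥0∞) < τ.dim b) → CuntzLE a b

variable (A) in
/-- The radius of comparison of a unital C*-algebra: the infimum of all `r ≥ 0` such that `A` has
`r`-comparison, and `⊤` if there is no such `r`. -/
def radiusOfComparison : ℝ≥0∞ :=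
  ⨅ (r : ℝ≥0) (_ : HasRComparison A r), (r : ℝ≥0∞)

end

/-!
For every natural number `j`, a compact Hausdorff space `X` with `dim X ≥ 2 j` satisfies
`rc (C(X)) ≥ j - 2`. All five cases follow by choosing `j`.

Since `dim X ≥ 2 j`, some continuous `f : X → ℂ^j` without zeros on a closed set `A` agrees on `A`
with no continuous map without zeros on `X`. This is the half of the classical characterization of
dimension by maps to spheres that is proved in `NonvanishingExtension.hasOpenRefinements`: a
partition of unity is a map to a simplex, and if extensions exist, then it can be pushed off the
simplices of large dimension, one at a time.

Scaling and retracting `f` radially yields `u : X → ℂ^j` of length at most one, and of length one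
near `A`. The positive element `b = 1 - u u⋆` of `M_j(C(X))` has rank at least `j - 1` everywhere,
and where `u` has length one its range is the orthogonal complement of `u`. Thus `r`-comparison for
some `r < j - 2` makes the constant projection `e₀₀` of rank one Cuntz subequivalent to `b`, which
yields a section `s` of the range of `b` without zeros
(`HasRComparison.exists_orthogonal`). Near `A` the vectors `s` and `f` are orthogonal, so that no
convex combination `t f + (1 - t) s` with `t > 0` vanishes. With a cutoff function `t` that is `1`
on `A` and supported near `A`, this combination is a map without zeros that agrees with `f` on `A`
(`HasRComparison.nonvanishingExtension`), a contradiction.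

The rank estimates have to hold for all quasitraces `τ`, but need no classification of these:
`b ≤ b^(1/k)` gives `d_τ(b) ≥ τ(b)`, and `τ(u u⋆) = τ(u⋆ u) ≤ τ(e₀₀) = 1` gives `τ(b) ≥ j - 1`,
where only the additivity of `τ` on commuting elements is used
(`NormalizedQuasitrace.natCast_le_dim_one_sub`).
-/

/-! ### Nonvanishing extensions and covering dimension -/

/-- Every continuous `F : X → ℝ^ι` without zeros on a closed set `A` agrees on `A` with a
continuous map without zeros on `X`. For `ι` of cardinality `m` this says that every continuous
map from a closed subset of `X` to the sphere of dimension `m - 1` extends to `X`. -/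
def NonvanishingExtension (X ι : Type*) [TopologicalSpace X] : Prop :=
  ∀ (A : Set X) (F : X → ι → ℝ), IsClosed A → Continuous F → (∀ x ∈ A, F x ≠ 0) →
    ∃ G : X → ι → ℝ, Continuous G ∧ (∀ x, G x ≠ 0) ∧ ∀ x ∈ A, G x = F x

/-- Two continuous maps on closed sets `A` and `B` that agree on `A ∩ B` have, when the target is
`ℝ^ι` and the space is normal, a common continuous extension. -/
lemma exists_continuous_extension_of_eqOn_inter {X ι : Type*} [TopologicalSpace X] [NormalSpace X]
    {A B : Set X} (hA : IsClosed A) (hB : IsClosed B) {f g : X → ι → ℝ}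
    (hf : Continuous f) (hg : Continuous g) (hfg : ∀ x ∈ A, x ∈ B → f x = g x) :
    ∃ h : X → ι → ℝ, Continuous h ∧ (∀ x ∈ A, h x = f x) ∧ ∀ x ∈ B, h x = g x := by
  classical
  have h1 : ∀ x ∈ A, A.piecewise f g x = f x := fun x hx => Set.piecewise_eq_of_mem A f g hx
  have h2 : ∀ x ∈ B, A.piecewise f g x = g x := fun x hx => by
    by_cases hxA : x ∈ A
    · rw [h1 x hxA, hfg x hxA hx]
    · exact Set.piecewise_eq_of_notMem A f g hxA
  have hcont : ContinuousOn (A.piecewise f g) (A ∪ B) :=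
    (hf.continuousOn.congr h1).union_of_isClosed (hg.continuousOn.congr h2) hA hB
  obtain ⟨h, hh⟩ := ContinuousMap.exists_restrict_eq (hA.union hB)
    ⟨_, continuousOn_iff_continuous_domRestrict.mp hcont⟩
  have hval : ∀ x ∈ A ∪ B, h x = A.piecewise f g x := fun x hx => DFunLike.congr_fun hh ⟨x, hx⟩
  exact ⟨h, h.continuous, fun x hx => (hval x (Or.inl hx)).trans (h1 x hx),
    fun x hx => (hval x (Or.inr hx)).trans (h2 x hx)⟩

/-- The extension property passes to higher dimensions: the first block of coordinates has to be
made nonvanishing only where the remaining coordinates vanish. -/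
lemma NonvanishingExtension.of_embedding {X ι κ : Type*} [TopologicalSpace X] [NormalSpace X]
    (h : NonvanishingExtension X ι) (e : ι ↪ κ) : NonvanishingExtension X κ := by
  classical
  intro A F hA hF hF0
  set Z : Set X := {x | ∀ k, k ∉ Set.range e → F x k = 0} with hZ
  have hZc : IsClosed Z := by
    simp only [hZ, Set.ofPred_forall]
    exact isClosed_iInter fun k => isClosed_iInter fun _ =>
      isClosed_eq ((continuous_apply k).comp hF) continuous_const
  have hFe : Continuous fun x i => F x (e i) :=
    continuous_pi fun i => (continuous_apply (e i)).comp hF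
  obtain ⟨g, hg, hg0, hgF⟩ := h (A ∩ Z) (fun x i => F x (e i)) (hA.inter hZc) hFe <| by
    rintro x ⟨hxA, hxZ⟩ h0
    refine hF0 x hxA (funext fun k => ?_)
    by_cases hk : k ∈ Set.range e
    · obtain ⟨i, rfl⟩ := hk
      exact congrFun h0 i
    · exact hxZ k hk
  obtain ⟨G, hG, hGA, hGZ⟩ := exists_continuous_extension_of_eqOn_inter hA hZc hFe hg
    fun x hxA hxZ => (hgF x ⟨hxA, hxZ⟩).symm
  refine ⟨fun x => Function.extend e (G x) (F x), continuous_pi fun k => ?_,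
    fun x (h0 : Function.extend e (G x) (F x) = 0) => ?_, fun x hx => funext fun k => ?_⟩
  · by_cases hk : ∃ i, e i = k
    · obtain ⟨i, rfl⟩ := hk
      simp only [e.injective.extend_apply]
      exact (continuous_apply i).comp hG
    · simp only [Function.extend_apply' _ _ _ hk]
      exact (continuous_apply k).comp hF
  · have hxZ : x ∈ Z := fun k hk => by
      rw [← Function.extend_apply' (G x) (F x) k hk, h0, Pi.zero_apply]
    refine hg0 x (funext fun i => ?_)
    rw [← hGZ x hxZ, ← e.injective.extend_apply (G x) (F x) i, h0, Pi.zero_apply, Pi.zero_apply]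
  · beta_reduce
    by_cases hk : ∃ i, e i = k
    · obtain ⟨i, rfl⟩ := hk
      rw [e.injective.extend_apply, hGA x hx]
    · rw [Function.extend_apply' _ _ _ hk]

/-- One step of pushing a map to a simplicial complex into a lower skeleton. The nonnegative
functions `ψ x i` are barycentric coordinates up to scaling, and `σ` is a simplex such that no
point of `X` lies in the interior of a simplex strictly containing `σ`. Then the map can be
changed on the preimage of `σ` so that it avoids the interior of `σ`. -/
lemma NonvanishingExtension.push_off_simplex {X ι κ : Type*} [TopologicalSpace X]
    [NormalSpace X] [Fintype ι] [Fintype κ] (h : NonvanishingExtension X ι)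
    {ψ : X → κ → ℝ} (hψ : Continuous ψ) (hnonneg : ∀ x i, 0 ≤ ψ x i) (hne : ∀ x, ψ x ≠ 0)
    {σ : Finset κ} (hcard : Fintype.card ι < σ.card)
    (hmax : ∀ x, (∀ i ∈ σ, 0 < ψ x i) → ∀ i ∉ σ, ψ x i = 0) :
    ∃ ψ' : X → κ → ℝ, Continuous ψ' ∧ (∀ x i, 0 ≤ ψ' x i) ∧ (∀ x, ψ' x ≠ 0) ∧
      (∀ x i, 0 < ψ' x i → 0 < ψ x i) ∧ ∀ x, ∃ i ∈ σ, ψ' x i = 0 := by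
  classical
  have hσ : σ.Nonempty := Finset.card_pos.mp (by omega)
  obtain ⟨i₀, hi₀⟩ := hσ
  obtain ⟨e⟩ : Nonempty (ι ↪ {i // i ∈ σ.erase i₀}) := by
    apply Function.Embedding.nonempty_of_card_le
    rw [Fintype.card_coe, Finset.card_erase_of_mem hi₀]
    omega
  have hψi : ∀ i, Continuous fun x => ψ x i := fun i => (continuous_apply i).comp hψ
  set Y : Set X := {x | ∃ i ∈ σ, ψ x i = 0} with hY
  set Z : Set X := {x | ∀ i ∉ σ, ψ x i = 0} with hZ
  have hYc : IsClosed Y := by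
    have : Y = ⋃ i ∈ σ, {x | ψ x i = 0} := by ext; simp [hY]
    rw [this]
    exact σ.finite_toSet.isClosed_biUnion fun i _ => isClosed_eq (hψi i) continuous_const
  have hZc : IsClosed Z := by
    simp only [hZ, Set.ofPred_forall]
    exact isClosed_iInter fun i => isClosed_iInter fun _ => isClosed_eq (hψi i) continuous_const
  have hYZ : ∀ x, x ∉ Y → x ∈ Z := fun x hx => hmax x fun i hi =>
    (hnonneg x i).lt_of_ne fun h0 => hx ⟨i, hi, h0.symm⟩
  -- Subtracting the coordinate `i₀` identifies the cone over the boundary of `σ` with `ℝ^(σ \ i₀)`.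
  obtain ⟨G, hG, hG0, hGF⟩ := h.of_embedding e (Y ∩ Z) (fun x i => ψ x i - ψ x i₀)
    (hYc.inter hZc) (continuous_pi fun i => (hψi i).sub (hψi i₀)) <| by
      rintro x ⟨⟨j, hj, hj0⟩, hxZ⟩ h0
      have heq : ∀ i ∈ σ, ψ x i = ψ x i₀ := fun i hi => by
        by_cases hii : i = i₀
        · rw [hii]
        · exact sub_eq_zero.mp (congrFun h0 ⟨i, Finset.mem_erase.mpr ⟨hii, hi⟩⟩)
      refine hne x (funext fun i => ?_)
      by_cases hi : i ∈ σ
      · rw [heq i hi, ← heq j hj, hj0, Pi.zero_apply]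
      · exact hxZ i hi
  set w : X → κ → ℝ := fun x i => if hi : i ∈ σ.erase i₀ then G x ⟨i, hi⟩ else 0 with hw
  have hwi : ∀ i, Continuous fun x => w x i := fun i => by
    by_cases hi : i ∈ σ.erase i₀
    · simp only [hw, hi, dite_true]
      exact (continuous_apply _).comp hG
    · simpa only [hw, hi, dite_false] using continuous_const
  have hw₀ : ∀ x, w x i₀ = 0 := fun x => by simp [hw]
  have hwψ : ∀ x ∈ Y ∩ Z, ∀ i ∈ σ, w x i = ψ x i - ψ x i₀ := fun x hx i hi => by
    by_cases hii : i = i₀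
    · rw [hii, hw₀, sub_self]
    · have hi' : i ∈ σ.erase i₀ := Finset.mem_erase.mpr ⟨hii, hi⟩
      simp only [hw, hi', dite_true, hGF x hx]
  have hσ : σ.Nonempty := ⟨i₀, hi₀⟩
  set μ : X → ℝ := fun x => σ.inf' hσ (w x) with hμ
  have hμc : Continuous μ := Continuous.finset_inf'_apply hσ fun i _ => hwi i
  have hμle : ∀ x, ∀ i ∈ σ, μ x ≤ w x i := fun x i hi => Finset.inf'_le _ hi
  have hμex : ∀ x, ∃ i ∈ σ, μ x = w x i := fun x => Finset.exists_mem_eq_inf' hσ (w x)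
  set η : X → κ → ℝ := fun x i => if i ∈ σ then w x i - μ x else 0 with hη
  have hηc : Continuous η := continuous_pi fun i => by
    by_cases hi : i ∈ σ
    · simp only [hη, hi, if_true]
      exact (hwi i).sub hμc
    · simpa only [hη, hi, if_false] using continuous_const
  have hagree : ∀ x ∈ Y, x ∈ Z → ψ x = η x := fun x hxY hxZ => by
    have hwx := hwψ x ⟨hxY, hxZ⟩
    have hμx : μ x = - ψ x i₀ := by
      obtain ⟨j, hj, hj0⟩ := hxY
      obtain ⟨i, hi, hi'⟩ := hμex x
      have h1 := hμle x j hj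
      rw [hwx j hj, hj0] at h1
      rw [hwx i hi] at hi'
      linarith [hnonneg x i]
    funext i
    by_cases hi : i ∈ σ
    · simp only [hη, hi, if_true, hwx i hi, hμx]
      ring
    · simp only [hη, hi, if_false, hxZ i hi]
  obtain ⟨ψ', hψ'c, hψ'Y, hψ'Z⟩ :=
    exists_continuous_extension_of_eqOn_inter hYc hZc hψ hηc hagree
  refine ⟨ψ', hψ'c, fun x i => ?_, fun x => ?_, fun x i hi => ?_, fun x => ?_⟩ <;>
  by_cases hx : x ∈ Y
  · rw [hψ'Y x hx]
    exact hnonneg x i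
  · rw [hψ'Z x (hYZ x hx)]
    by_cases hi : i ∈ σ
    · simp only [hη, hi, if_true, sub_nonneg, hμle x i hi]
    · simp only [hη, hi, if_false, le_refl]
  · rw [hψ'Y x hx]
    exact hne x
  · rw [hψ'Z x (hYZ x hx)]
    intro h0
    have hwμ : ∀ i ∈ σ, w x i = μ x := fun i hi => by
      have := congrFun h0 i
      simp only [hη, hi, if_true, Pi.zero_apply] at this
      exact sub_eq_zero.mp this
    refine hG0 x (funext fun i => ?_)
    have := hwμ i (Finset.mem_of_mem_erase i.2)
    rw [← hwμ i₀ hi₀, hw₀] at this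
    simp only [hw, i.2, dite_true] at this
    exact this
  · rwa [hψ'Y x hx] at hi
  · rw [hψ'Z x (hYZ x hx)] at hi
    have hiσ : i ∈ σ := by
      by_contra hiσ
      simp only [hη, hiσ, if_false, lt_irrefl] at hi
    exact (hnonneg x i).lt_of_ne fun h0 => hx ⟨i, hiσ, h0.symm⟩
  · rw [hψ'Y x hx]
    exact hx
  · rw [hψ'Z x (hYZ x hx)]
    obtain ⟨i, hi, hi'⟩ := hμex x
    exact ⟨i, hi, by simp only [hη, hi, if_true, hi', sub_self]⟩

/-- A map to a finite simplicial complex can be pushed into the skeleton of dimension `|ι| - 1`,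
one simplex of maximal dimension at a time. -/
lemma NonvanishingExtension.push_to_skeleton {X ι κ : Type*} [TopologicalSpace X]
    [NormalSpace X] [Fintype ι] [Fintype κ] (h : NonvanishingExtension X ι)
    {ψ : X → κ → ℝ} (hψ : Continuous ψ) (hnonneg : ∀ x i, 0 ≤ ψ x i) (hne : ∀ x, ψ x ≠ 0) :
    ∃ ψ' : X → κ → ℝ, Continuous ψ' ∧ (∀ x i, 0 ≤ ψ' x i) ∧ (∀ x, ψ' x ≠ 0) ∧
      (∀ x i, 0 < ψ' x i → 0 < ψ x i) ∧ ∀ x, {i | 0 < ψ' x i}.encard ≤ Fintype.card ι := by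
  classical
  set nerve : (X → κ → ℝ) → Finset (Finset κ) :=
    fun ψ => Finset.univ.filter fun σ => ∃ x, ∀ i ∈ σ, 0 < ψ x i with hnerve
  have hmem : ∀ ψ σ, σ ∈ nerve ψ ↔ ∃ x, ∀ i ∈ σ, 0 < ψ x i := by simp [hnerve]
  induction hN : (nerve ψ).card using Nat.strong_induction_on generalizing ψ with
  | _ N ih =>
  by_cases hbig : ∃ σ ∈ nerve ψ, Fintype.card ι < σ.card
  · obtain ⟨σ, hσ, hσmax⟩ := Finset.exists_max_image (nerve ψ) Finset.card
      (let ⟨σ, hσ, _⟩ := hbig; ⟨σ, hσ⟩)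
    have hcard : Fintype.card ι < σ.card :=
      let ⟨τ, hτ, hτc⟩ := hbig; hτc.trans_le (hσmax τ hτ)
    have hmax : ∀ x, (∀ i ∈ σ, 0 < ψ x i) → ∀ i ∉ σ, ψ x i = 0 := by
      intro x hx i hi
      by_contra h0
      have hin : insert i σ ∈ nerve ψ := (hmem _ _).mpr ⟨x, fun k hk => by
        rcases Finset.mem_insert.mp hk with rfl | hk
        · exact (hnonneg x k).lt_of_ne (Ne.symm h0)
        · exact hx k hk⟩
      have := hσmax _ hin
      rw [Finset.card_insert_of_notMem hi] at this
      omega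
    obtain ⟨ψ', hψ', hnonneg', hne', hsupp, havoid⟩ :=
      h.push_off_simplex hψ hnonneg hne hcard hmax
    have hlt : (nerve ψ').card < N := by
      rw [← hN]
      refine Finset.card_lt_card ⟨fun τ hτ => ?_, fun hsub => ?_⟩
      · obtain ⟨x, hx⟩ := (hmem _ _).mp hτ
        exact (hmem _ _).mpr ⟨x, fun i hi => hsupp x i (hx i hi)⟩
      · obtain ⟨x, hx⟩ := (hmem _ _).mp (hsub hσ)
        obtain ⟨i, hi, hi0⟩ := havoid x
        exact (hx i hi).ne' hi0
    obtain ⟨ψ'', h1, h2, h3, h4, h5⟩ := ih _ hlt hψ' hnonneg' hne' rfl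
    exact ⟨ψ'', h1, h2, h3, fun x i hi => hsupp x i (h4 x i hi), h5⟩
  · push Not at hbig
    refine ⟨ψ, hψ, hnonneg, hne, fun _ _ => id, fun x => ?_⟩
    have hx := hbig (Finset.univ.filter fun i => 0 < ψ x i)
      ((hmem _ _).mpr ⟨x, fun i hi => (Finset.mem_filter.mp hi).2⟩)
    have hcoe : {i | 0 < ψ x i} = ((Finset.univ.filter fun i => 0 < ψ x i : Finset κ) : Set κ) := by
      ext; simp
    rw [hcoe, Set.encard_coe_eq_coe_finsetCard]
    exact_mod_cast hx

/-- If maps from closed sets to the sphere of dimension `|ι| - 1` extend, then the covering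
dimension is at most `|ι| - 1`. -/
lemma NonvanishingExtension.hasOpenRefinements {X ι : Type*} [TopologicalSpace X]
    [CompactSpace X] [T2Space X] [Fintype ι] (h : NonvanishingExtension X ι) :
    HasOpenRefinements X (Fintype.card ι) := by
  intro U hUfin hUo hUcov
  have := hUfin.fintype
  obtain ⟨f, hf⟩ := PartitionOfUnity.exists_isSubordinate (isClosed_univ (X := X))
    (fun u : U => (u : Set X)) (fun u => hUo u u.2) (by rw [← Set.sUnion_eq_iUnion, hUcov])
  obtain ⟨ψ, hψ, hnonneg, hne, hsupp, hcard⟩ := h.push_to_skeleton (ψ := fun x u => f u x)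
    (continuous_pi fun u => (f u).continuous) (fun x u => f.nonneg u x) fun x h0 => by
      have hsum := f.sum_eq_one (Set.mem_univ x)
      rw [finsum_eq_zero_of_forall_eq_zero fun u => congrFun h0 u] at hsum
      exact zero_ne_one hsum
  have hcov : ∀ x, ∃ u, 0 < ψ x u := fun x => by
    obtain ⟨u, hu⟩ := Function.ne_iff.mp (hne x)
    exact ⟨u, (hnonneg x u).lt_of_ne (Ne.symm hu)⟩
  refine ⟨Set.range fun u => {x | 0 < ψ x u}, ?_, ?_, ?_, fun x => ?_⟩
  · rintro _ ⟨u, rfl⟩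
    exact isOpen_lt continuous_const ((continuous_apply u).comp hψ)
  · refine Set.eq_univ_of_forall fun x => ?_
    obtain ⟨u, hu⟩ := hcov x
    exact ⟨_, ⟨u, rfl⟩, hu⟩
  · rintro _ ⟨u, rfl⟩
    exact ⟨u, u.2, fun x hx => hf u (subset_tsupport _ (hsupp x u hx).ne')⟩
  · refine le_trans ?_ (hcard x)
    refine (Set.encard_le_encard (t := (fun u => {x | 0 < ψ x u}) '' {u | 0 < ψ x u}) ?_).trans
      (Set.encard_image_le _ _)
    rintro _ ⟨⟨u, rfl⟩, hu⟩
    exact ⟨u, hu, rfl⟩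

/-! ### Quasitraces on commuting elements and on matrix units -/

/-- Commuting self-adjoint elements generate a commutative ⋆-subalgebra, where `τ` is linear. -/
lemma IsQuasitrace.map_add_of_commute {B : Type*} [CStarAlgebra B] {τ : B → ℂ}
    (hτ : IsQuasitrace τ) {a b : B} (ha : IsSelfAdjoint a) (hb : IsSelfAdjoint b)
    (hab : Commute a b) : τ (a + b) = τ a + τ b := by
  have hs : ∀ x ∈ ({a, b} : Set B), ∀ y ∈ ({a, b} : Set B), Commute x y := by
    rintro x (rfl | rfl) y (rfl | rfl)
    exacts [Commute.refl _, hab, hab.symm, Commute.refl _]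
  have hstar : ∀ x ∈ ({a, b} : Set B), star x = x := by
    rintro x (rfl | rfl)
    exacts [ha, hb]
  have hcomm : ∀ x ∈ NonUnitalStarAlgebra.adjoin ℂ {a, b},
      ∀ y ∈ NonUnitalStarAlgebra.adjoin ℂ {a, b}, x * y = y * x := by
    have h1 : ∀ x ∈ ({a, b} : Set B), ∀ y ∈ NonUnitalStarAlgebra.adjoin ℂ {a, b},
        Commute x y := fun x hx y hy =>
      NonUnitalStarAlgebra.commute_of_mem_adjoin_of_forall_mem_commute hy
        (fun z hz => hs x hx z hz) fun z hz => by rw [hstar z hz]; exact hs x hx z hz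
    intro x hx y hy
    exact (NonUnitalStarAlgebra.commute_of_mem_adjoin_of_forall_mem_commute hx
        (fun z hz => (h1 z hz y hy).symm)
        fun z hz => by rw [hstar z hz]; exact (h1 z hz y hy).symm).symm
  exact (hτ.linear_of_commutative _ hcomm).map_add
    ⟨a, NonUnitalStarAlgebra.subset_adjoin ℂ _ (Set.mem_insert a {b})⟩
    ⟨b, NonUnitalStarAlgebra.subset_adjoin ℂ _ (Set.mem_insert_of_mem a rfl)⟩

lemma IsQuasitrace.map_zero {B : Type*} [CStarAlgebra B] {τ : B → ℂ} (hτ : IsQuasitrace τ) :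
    τ 0 = 0 := by
  simpa using hτ.map_add_of_commute (a := 0) (b := 0) (.zero _) (.zero _) (.refl _)

lemma IsQuasitrace.map_sum_of_commute {B ι : Type*} [CStarAlgebra B] {τ : B → ℂ}
    (hτ : IsQuasitrace τ) (f : ι → B) (hf : ∀ i, IsSelfAdjoint (f i))
    (hc : ∀ i j, Commute (f i) (f j)) (s : Finset ι) : τ (∑ i ∈ s, f i) = ∑ i ∈ s, τ (f i) := by
  classical
  induction s using Finset.induction_on with
  | empty => simpa using hτ.map_zero
  | insert i s hi ih =>
    rw [Finset.sum_insert hi, Finset.sum_insert hi, hτ.map_add_of_commute (hf i)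
      (isSelfAdjoint_sum _ fun j _ => hf j) (Commute.sum_right _ _ _ fun j _ => hc i j), ih]

lemma IsQuasitrace.mono_of_commute {B : Type*} [CStarAlgebra B] [PartialOrder B]
    [StarOrderedRing B] {τ : B → ℂ} (hτ : IsQuasitrace τ) {a b : B} (ha : IsSelfAdjoint a)
    (hab : Commute a b) (hle : a ≤ b) : τ a ≤ τ b := by
  have hsub := sub_nonneg.mpr hle
  have hadd := hτ.map_add_of_commute ha hsub.isSelfAdjoint (hab.sub_right (.refl a))
  rw [add_sub_cancel] at hadd
  obtain ⟨y, hy⟩ := CStarAlgebra.nonneg_iff_eq_star_mul_self.mp hsub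
  rw [hadd, hy]
  exact le_add_of_nonneg_right (hτ.nonneg y)

lemma posPow_eq_self_of_isStarProjection {B : Type*} [CStarAlgebra B] [PartialOrder B]
    [StarOrderedRing B] {p : B} (hp : IsStarProjection p) {r : ℝ} (hr : 0 < r) :
    posPow p r = p := by
  have hp0 : 0 ≤ p := hp.nonneg
  rw [posPow, CFC.rpow_eq_cfc_real hp0]
  conv_rhs => rw [← cfc_id' ℝ p]
  refine cfc_congr fun t ht => ?_
  rcases (isIdempotentElem_iff_spectrum_subset ℝ p hp.isSelfAdjoint).mp hp.isIdempotentElem ht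
    with rfl | rfl
  · simp [Real.zero_rpow hr.ne']
  · simp

lemma le_posPow_of_le_one {B : Type*} [CStarAlgebra B] [PartialOrder B]
    [StarOrderedRing B] {b : B} (hb : 0 ≤ b) (hb1 : b ≤ 1) {r : ℝ} (hr : 0 < r) (hr1 : r ≤ 1) :
    b ≤ posPow b r := by
  rw [posPow, CFC.rpow_eq_cfc_real hb]
  conv_lhs => rw [← cfc_id' ℝ b]
  refine cfc_mono (fun t ht => ?_) continuousOn_id
    (Real.continuous_rpow_const hr.le).continuousOn
  exact Real.self_le_rpow_of_le_one (spectrum_nonneg_of_nonneg hb ht)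
    ((CFC.le_one_iff b).mp hb1 t ht) hr1

lemma commute_posPow {B : Type*} [CStarAlgebra B] [PartialOrder B]
    [StarOrderedRing B] (b : B) (r : ℝ) : Commute b (posPow b r) := by
  by_cases hb : 0 ≤ b
  · rw [posPow, CFC.rpow_def]
    conv => arg 1; rw [← cfc_id' ℝ≥0 b]
    exact cfc_commute_cfc _ _ b
  · rw [posPow, CFC.rpow_def, cfc_apply_of_not_predicate b hb]
    exact Commute.zero_right b

namespace CStarMatrix

variable {A : Type*} [CStarAlgebra A] {n : ℕ}

/-- The matrix with entry `a` in position `(i, j)` and zeros elsewhere. -/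
def single (i j : Fin n) (a : A) : CStarMatrix (Fin n) (Fin n) A :=
  ofMatrix (Matrix.single i j a)

lemma single_apply (i j : Fin n) (a : A) (k l : Fin n) :
    single i j a k l = if i = k ∧ j = l then a else 0 := rfl

lemma star_single (i j : Fin n) (a : A) : star (single i j a) = single j i (star a) :=
  Matrix.conjTranspose_single i j a

lemma single_mul_single (i j k : Fin n) (a b : A) :
    single i j a * single j k b = single i k (a * b) :=
  Matrix.single_mul_single_same a i j k b

lemma single_mul_single_of_ne {i j k l : Fin n} (h : j ≠ k) (a b : A) :
    single i j a * single k l b = 0 :=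
  Matrix.single_mul_single_of_ne a i j k h b

lemma sum_single_one : ∑ i : Fin n, single i i (1 : A) = 1 :=
  Matrix.sum_single_one

lemma isStarProjection_single_one (i : Fin n) : IsStarProjection (single i i (1 : A)) where
  isIdempotentElem := by rw [IsIdempotentElem, single_mul_single, one_mul]
  isSelfAdjoint := by rw [IsSelfAdjoint, star_single, star_one]

end CStarMatrix

open CStarMatrix

namespace NormalizedQuasitrace

variable {A : Type*} [CStarAlgebra A] [PartialOrder A] [StarOrderedRing A]

lemma map_single_zero (τ : NormalizedQuasitrace A) (n : ℕ) :
    τ.toFun (n + 1) (single 0 0 1) = 1 := by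
  induction n with
  | zero =>
    rw [← τ.map_one]
    congr 1
    ext i j
    fin_cases i
    fin_cases j
    exact Matrix.single_apply_same 0 0 1
  | succ n ih =>
    rw [← ih, τ.corner]
    · congr 1
      ext i j
      simp only [CStarMatrix.single, ofMatrix_apply, Matrix.single_apply, Fin.ext_iff,
        Fin.val_castSucc, Fin.val_zero]
      rfl
    · intro i
      exact Matrix.single_apply_of_col_ne _ _ Fin.last_pos.ne _
    · intro j
      exact Matrix.single_apply_of_row_ne Fin.last_pos.ne _ _ _

lemma map_single_diag (τ : NormalizedQuasitrace A) {n : ℕ} (i : Fin (n + 1)) :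
    τ.toFun (n + 1) (single i i 1) = 1 := by
  have h := (τ.isQuasitrace (n + 1)).tracial (single 0 i 1)
  rw [star_single, single_mul_single, single_mul_single, star_one, one_mul, map_single_zero] at h
  exact h

lemma map_one_eq (τ : NormalizedQuasitrace A) (n : ℕ) : τ.toFun (n + 1) 1 = n + 1 := by
  rw [← sum_single_one, (τ.isQuasitrace (n + 1)).map_sum_of_commute]
  · simp [map_single_diag]
  · exact fun i => (isStarProjection_single_one i).isSelfAdjoint
  · intro i j
    by_cases hij : i = j
    · subst hij
      exact Commute.refl _
    · rw [Commute, SemiconjBy, single_mul_single_of_ne hij, single_mul_single_of_ne (Ne.symm hij)]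

lemma dim_single_zero (τ : NormalizedQuasitrace A) (n : ℕ) :
    τ.dim (single (0 : Fin (n + 1)) 0 (1 : A)) = 1 := by
  have h : ∀ k : ℕ, posPow (single (0 : Fin (n + 1)) 0 (1 : A)) (1 / ((k : ℝ) + 1)) =
      single 0 0 1 :=
    fun k => posPow_eq_self_of_isStarProjection (isStarProjection_single_one 0) (by positivity)
  simp only [dim, h, map_single_zero, Complex.one_re, ENNReal.ofReal_one, limsup_const]

/-- A contraction `b ≥ 0` satisfies `b ≤ b^(1/k)`, so that `τ b` is a lower bound for `d_τ(b)`. -/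
lemma le_dim (τ : NormalizedQuasitrace A) {n : ℕ} {b : CStarMatrix (Fin n) (Fin n) A}
    (hb : 0 ≤ b) (hb1 : b ≤ 1) : ENNReal.ofReal (τ.toFun n b).re ≤ τ.dim b := by
  rw [dim, ← limsup_const (f := (atTop : Filter ℕ)) (ENNReal.ofReal (τ.toFun n b).re)]
  refine limsup_le_limsup (Eventually.of_forall fun k => ENNReal.ofReal_le_ofReal ?_)
  have hr1 : 1 / ((k : ℝ) + 1) ≤ 1 := div_le_one_of_le₀ (by linarith [k.cast_nonneg (α := ℝ)])
    (by positivity)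
  exact (Complex.le_def.mp ((τ.isQuasitrace n).mono_of_commute hb.isSelfAdjoint
    (commute_posPow b _) (le_posPow_of_le_one hb hb1 (by positivity) hr1))).1

/-- If `x⋆ x` is bounded by a rank one matrix unit, then `1 - x x⋆` has corank at most one, since
`τ(x x⋆) = τ(x⋆ x) ≤ 1`. The element `y` witnesses the bound. -/
lemma natCast_le_dim_one_sub (τ : NormalizedQuasitrace A) {n : ℕ}
    {x y : CStarMatrix (Fin (n + 1)) (Fin (n + 1)) A}
    (hxy : star x * x + star y * y = single 0 0 1)
    (hcomm : Commute (star x * x) (single 0 0 1)) (h0 : 0 ≤ 1 - x * star x) :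
    (n : ℝ≥0∞) ≤ τ.dim (1 - x * star x) := by
  have hτ := τ.isQuasitrace (n + 1)
  have hle : τ.toFun (n + 1) (x * star x) ≤ 1 := by
    rw [← hτ.tracial, ← τ.map_single_zero n]
    refine hτ.mono_of_commute (.star_mul_self x) hcomm ?_
    rw [← hxy]
    exact le_add_of_nonneg_right (star_mul_self_nonneg y)
  have hadd := hτ.map_add_of_commute (a := x * star x) (b := 1 - x * star x) (.mul_star_self x)
    h0.isSelfAdjoint ((Commute.one_right _).sub_right (.refl _))
  rw [add_sub_cancel, τ.map_one_eq] at hadd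
  refine le_trans ?_ (τ.le_dim h0 (sub_le_self 1 (mul_star_self_nonneg x)))
  rw [← ENNReal.ofReal_natCast]
  apply ENNReal.ofReal_le_ofReal
  have h1 := (Complex.le_def.mp hle).1
  have h2 := congrArg Complex.re hadd
  simp only [Complex.add_re, Complex.natCast_re, Complex.one_re] at h1 h2
  linarith

end NormalizedQuasitrace

/-- If `x⋆ x` is bounded by a projection, then `x x⋆ ≤ 1`. -/
lemma one_sub_mul_star_nonneg {B : Type*} [CStarAlgebra B] [PartialOrder B] [StarOrderedRing B]
    {x y p : B} (hp : IsStarProjection p) (hxy : star x * x + star y * y = p) :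
    0 ≤ 1 - x * star x := by
  have hle : star x * x ≤ 1 := by
    refine le_trans ?_ hp.le_one
    rw [← hxy]
    exact le_add_of_nonneg_right (star_mul_self_nonneg y)
  have h1 := (CStarAlgebra.norm_le_one_iff_of_nonneg _ (star_mul_self_nonneg x)).mpr hle
  rw [CStarRing.norm_star_mul_self, ← CStarRing.norm_self_mul_star] at h1
  exact sub_nonneg.mpr ((CStarAlgebra.norm_le_one_iff_of_nonneg _ (mul_star_self_nonneg x)).mp h1)

/-! ### Comparison produces nonvanishing extensions -/

namespace CStarMatrix

variable {X : Type*} [TopologicalSpace X] {n : ℕ}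

/-- The matrix with first column `u` and zeros elsewhere. -/
noncomputable def column (u : Fin (n + 1) → C(X, ℂ)) :
    CStarMatrix (Fin (n + 1)) (Fin (n + 1)) C(X, ℂ) :=
  ofMatrix fun i j => if j = 0 then u i else 0

lemma column_apply (u : Fin (n + 1) → C(X, ℂ)) (i j : Fin (n + 1)) :
    column u i j = if j = 0 then u i else 0 := rfl

lemma star_column_mul_column [CompactSpace X] (u : Fin (n + 1) → C(X, ℂ)) :
    star (column u) * column u = single 0 0 (∑ k, star (u k) * u k) := by
  ext1 i j
  rw [mul_apply]
  by_cases hi : i = 0 <;> by_cases hj : j = 0 <;>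
    simp [column_apply, single_apply, star_apply, hi, hj, Ne.symm]

lemma column_mul_star_column_apply (u : Fin (n + 1) → C(X, ℂ)) (i j : Fin (n + 1)) :
    (column u * star (column u)) i j = u i * star (u j) := by
  rw [mul_apply, Finset.sum_eq_single 0]
  · simp [column_apply, star_apply]
  · intro k _ hk
    simp [column_apply, star_apply, hk]
  · simp

end CStarMatrix

section

variable {X : Type*} [TopologicalSpace X] [CompactSpace X]

/-- If `e₀₀` is Cuntz subequivalent to `b`, then the range of `b` has a section without zeros;
here it is `b r⋆` for a row `r`. -/
lemma CuntzLE.exists_row {n : ℕ} {b : CStarMatrix (Fin (n + 1)) (Fin (n + 1)) C(X, ℂ)}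
    (h : CuntzLE (single 0 0 1) b) :
    ∃ r : Fin (n + 1) → C(X, ℂ), ∀ x, ∃ i, ∑ k, b i k x * star (r k x) ≠ 0 := by
  obtain ⟨v, hv⟩ := h
  obtain ⟨m, hm⟩ := (Metric.tendsto_atTop.mp hv 1 one_pos)
  have hlt := hm m le_rfl
  rw [dist_eq_norm] at hlt
  refine ⟨fun k => v m 0 k, fun x => ?_⟩
  by_contra! hzero
  have hentry : (v m * b * star (v m)) 0 0 x = 0 := by
    rw [mul_assoc, mul_apply, ContinuousMap.sum_apply]
    refine Finset.sum_eq_zero fun i _ => ?_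
    rw [ContinuousMap.mul_apply, mul_apply, ContinuousMap.sum_apply]
    exact mul_eq_zero_of_right _ (hzero i)
  have h1 := (ContinuousMap.norm_coe_le_norm _ x).trans
    (norm_entry_le_norm (M := v m * b * star (v m) - single 0 0 1) (i := 0) (j := 0))
  rw [CStarMatrix.sub_apply, ContinuousMap.sub_apply, hentry] at h1
  have h2 : (single (0 : Fin (n + 1)) 0 (1 : C(X, ℂ))) 0 0 x = 1 := by
    simp [single_apply]
  rw [h2, zero_sub, norm_neg, norm_one] at h1
  exact hlt.not_ge h1

/-- For `u` from `X` to the unit ball of `ℂ^(n+1)`, comparison provides a vector field without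
zeros that is orthogonal to `u` wherever `u` has length one. -/
lemma HasRComparison.exists_orthogonal {r : ℝ≥0} (h : HasRComparison C(X, ℂ) r) {n : ℕ}
    (hr : (r : ℝ) + 1 < n) (u : Fin (n + 1) → C(X, ℂ)) (hu : ∀ x, ∑ i, ‖u i x‖ ^ 2 ≤ 1) :
    ∃ s : Fin (n + 1) → C(X, ℂ), (∀ x, ∃ i, s i x ≠ 0) ∧
      ∀ x, ∑ i, ‖u i x‖ ^ 2 = 1 → ∑ i, star (u i x) * s i x = 0 := by
  have hconj : ∀ z : ℂ, star z * z = ((‖z‖ ^ 2 : ℝ) : ℂ) := fun z => by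
    rw [Complex.star_def, ← Complex.normSq_eq_conj_mul_self, Complex.normSq_eq_norm_sq]
  -- `w` turns `u⋆ u ≤ 1` into the equation `u⋆ u + w⋆ w = 1`.
  let w : C(X, ℂ) := ⟨fun x => (Real.sqrt (1 - ∑ i, ‖u i x‖ ^ 2) : ℂ), by fun_prop⟩
  have hsum : star (column u) * column u + star (single 0 0 w) * single 0 0 w = single 0 0 1 := by
    rw [star_column_mul_column, star_single, single_mul_single]
    have : (∑ k, star (u k) * u k) + star w * w = 1 := by
      ext x
      simp only [ContinuousMap.add_apply, ContinuousMap.sum_apply, ContinuousMap.mul_apply,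
        ContinuousMap.star_apply, ContinuousMap.one_apply, hconj]
      have hw : ‖w x‖ ^ 2 = 1 - ∑ i, ‖u i x‖ ^ 2 := by
        simp only [w, ContinuousMap.coe_mk, Complex.norm_real, Real.norm_eq_abs, sq_abs]
        exact Real.sq_sqrt (sub_nonneg.mpr (hu x))
      rw [hw]
      push_cast
      ring
    rw [← this]
    exact (congrArg ofMatrix (Matrix.single_add (0 : Fin (n + 1)) (0 : Fin (n + 1))
      (∑ k, star (u k) * u k) (star w * w))).symm
  have hcomm : Commute (star (column u) * column u) (single (0 : Fin (n + 1)) 0 (1 : C(X, ℂ))) := by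
    rw [star_column_mul_column, Commute, SemiconjBy, single_mul_single, single_mul_single,
      one_mul, mul_one]
  have hb := one_sub_mul_star_nonneg (isStarProjection_single_one 0) hsum
  have hcuntz := h (n + 1) (single 0 0 1) (1 - column u * star (column u))
    (isStarProjection_single_one 0).nonneg hb fun τ => by
      refine lt_of_lt_of_le ?_ (τ.natCast_le_dim_one_sub hsum hcomm hb)
      rw [τ.dim_single_zero, add_comm]
      exact_mod_cast hr
  obtain ⟨ρ, hρ⟩ := hcuntz.exists_row
  refine ⟨fun i => ∑ k, (1 - column u * star (column u)) i k * star (ρ k), fun x => ?_,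
    fun x hx => ?_⟩
  · obtain ⟨i, hi⟩ := hρ x
    exact ⟨i, by simpa only [ContinuousMap.sum_apply, ContinuousMap.mul_apply,
      ContinuousMap.star_apply] using hi⟩
  · simp only [ContinuousMap.sum_apply, ContinuousMap.mul_apply, ContinuousMap.star_apply,
      CStarMatrix.sub_apply, column_mul_star_column_apply, ContinuousMap.sub_apply, Finset.mul_sum]
    rw [Finset.sum_comm]
    refine Finset.sum_eq_zero fun k _ => ?_
    have h1 : ∀ i, star (u i x) * (((1 : CStarMatrix (Fin (n + 1)) (Fin (n + 1)) C(X, ℂ)) i k x -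
        u i x * star (u k x)) * star (ρ k x)) =
        (if i = k then star (u i x) * star (ρ k x) else 0) -
          ((‖u i x‖ ^ 2 : ℝ) : ℂ) * (star (u k x) * star (ρ k x)) := fun i => by
      rw [← hconj, one_apply]
      split_ifs
      · simp only [ContinuousMap.one_apply]
        ring
      · simp only [ContinuousMap.zero_apply]
        ring
    simp only [h1]
    rw [Finset.sum_sub_distrib, ← Finset.sum_mul, ← Complex.ofReal_sum, hx]
    simp

/-- Comparison with a small constant makes all maps from closed sets to the sphere of dimension
`2 n + 1` in `ℂ^(n+1)` extend: two orthogonal maps to the sphere are homotopic, so that the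
vector field of `HasRComparison.exists_orthogonal` can be deformed into the given map. -/
lemma HasRComparison.nonvanishingExtension {r : ℝ≥0}
    (h : HasRComparison C(X, ℂ) r) {n : ℕ} (hr : (r : ℝ) + 1 < n) :
    NonvanishingExtension X (Fin (n + 1) ⊕ Fin (n + 1)) := by
  intro A F hA hF hF0
  have hFi : ∀ i, Continuous fun x => F x i := fun i => (continuous_apply i).comp hF
  let f : Fin (n + 1) → X → ℂ := fun i x => (F x (.inl i) : ℂ) + F x (.inr i) * Complex.I
  have hf : ∀ i, Continuous (f i) := fun i =>
    (Complex.continuous_ofReal.comp (hFi _)).add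
      ((Complex.continuous_ofReal.comp (hFi _)).mul continuous_const)
  let N : X → ℝ := fun x => ∑ i, ‖f i x‖ ^ 2
  have hN : Continuous N := continuous_finsetSum _ fun i _ => (hf i).norm.pow 2
  have hN0 : ∀ x, 0 ≤ N x := fun x => Finset.sum_nonneg fun i _ => sq_nonneg _
  have hNpos : ∀ x ∈ A, 0 < N x := fun x hx => by
    refine (hN0 x).lt_of_ne fun h0 => hF0 x hx ?_
    have hfi : ∀ i, f i x = 0 := fun i => by
      have := (Finset.sum_eq_zero_iff_of_nonneg fun i _ => sq_nonneg ‖f i x‖).mp h0.symm i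
        (Finset.mem_univ i)
      simpa using this
    funext k
    rcases k with i | i
    · simpa [f] using congrArg Complex.re (hfi i)
    · simpa [f] using congrArg Complex.im (hfi i)
  obtain ⟨ε, hε, hεN⟩ := hA.isCompact.exists_forall_le' hN.continuousOn hNpos
  -- `u` is the radial retraction of `f` to the unit ball, of length one where `ε / 2 ≤ N`.
  let M : X → ℝ := fun x => Real.sqrt (max (ε / 2) (N x))
  have hMpos : ∀ x, 0 < M x := fun x => Real.sqrt_pos.mpr (lt_max_of_lt_left (by linarith))
  have hM : Continuous M := (continuous_const.max hN).sqrt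
  let u : Fin (n + 1) → C(X, ℂ) := fun i => ⟨fun x => f i x / (M x : ℂ),
    (hf i).div (Complex.continuous_ofReal.comp hM)
      fun x => Complex.ofReal_ne_zero.mpr (hMpos x).ne'⟩
  have hu : ∀ x, ∑ i, ‖u i x‖ ^ 2 = N x / max (ε / 2) (N x) := fun x => by
    have hsq : M x ^ 2 = max (ε / 2) (N x) := Real.sq_sqrt (le_max_of_le_right (hN0 x))
    simp only [u, ContinuousMap.coe_mk, norm_div, div_pow, Complex.norm_real, Real.norm_eq_abs,
      sq_abs, hsq, N, Finset.sum_div]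
  obtain ⟨s, hs, hsu⟩ := h.exists_orthogonal hr u fun x => by
    rw [hu]
    exact div_le_one_of_le₀ (le_max_right _ _) (le_max_of_le_right (hN0 x))
  have hsf : ∀ x, ε / 2 ≤ N x → ∑ i, star (f i x) * s i x = 0 := fun x hx => by
    have h1 := hsu x (by rw [hu, max_eq_right hx, div_self (by linarith)])
    have h2 : ∀ i, star (f i x) * s i x = M x * (star (u i x) * s i x) := fun i => by
      have hM0 : (M x : ℂ) ≠ 0 := Complex.ofReal_ne_zero.mpr (hMpos x).ne'
      simp only [u, ContinuousMap.coe_mk, star_div₀, Complex.star_def, Complex.conj_ofReal]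
      field_simp
    simp only [h2, ← Finset.mul_sum, h1, mul_zero]
  -- The cutoff `t` is `1` on `A`, and positive only where `s` is orthogonal to `f`.
  let t : X → ℝ := fun x => max 0 (min 1 (N x / (ε / 2) - 1))
  have ht : Continuous t := continuous_const.max
    (continuous_const.min ((hN.div_const _).sub continuous_const))
  let g : Fin (n + 1) → X → ℂ := fun i x => t x * f i x + (1 - t x) * s i x
  have hg : ∀ i, Continuous (g i) := fun i =>
    ((Complex.continuous_ofReal.comp ht).mul (hf i)).add
      ((continuous_const.sub (Complex.continuous_ofReal.comp ht)).mul (s i).continuous)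
  have hg0 : ∀ x, ∃ i, g i x ≠ 0 := fun x => by
    rcases le_or_gt (N x) (ε / 2) with hx | hx
    · have ht0 : t x = 0 := max_eq_left <| (min_le_right _ _).trans <|
        sub_nonpos.mpr ((div_le_one (by linarith)).mpr hx)
      obtain ⟨i, hi⟩ := hs x
      exact ⟨i, by simpa [g, ht0] using hi⟩
    · by_contra! hzero
      have ht0 : 0 < t x := lt_max_of_lt_right <| lt_min one_pos <|
        sub_pos.mpr ((one_lt_div (by linarith)).mpr hx)
      have h1 : ∑ i, star (f i x) * g i x = ((t x * N x : ℝ) : ℂ) := by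
        have h2 : ∀ i, star (f i x) * g i x =
            t x * ((‖f i x‖ ^ 2 : ℝ) : ℂ) + (1 - t x) * (star (f i x) * s i x) := fun i => by
          rw [← Complex.normSq_eq_norm_sq, Complex.normSq_eq_conj_mul_self, Complex.star_def]
          simp only [g]
          ring
        simp only [h2, Finset.sum_add_distrib, ← Finset.mul_sum, hsf x hx.le, mul_zero, add_zero,
          ← Complex.ofReal_sum, N, Complex.ofReal_mul]
      simp only [hzero, mul_zero, Finset.sum_const_zero] at h1
      have h3 : t x * N x = 0 := by exact_mod_cast h1.symm
      exact (mul_pos ht0 (by linarith)).ne' h3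
  refine ⟨fun x => Sum.elim (fun i => (g i x).re) (fun i => (g i x).im), continuous_pi fun k => ?_,
    fun x h0 => ?_, fun x hx => ?_⟩
  · rcases k with i | i
    · exact Complex.continuous_re.comp (hg i)
    · exact Complex.continuous_im.comp (hg i)
  · obtain ⟨i, hi⟩ := hg0 x
    exact hi (Complex.ext (congrFun h0 (.inl i)) (congrFun h0 (.inr i)))
  · have ht1 : t x = 1 := by
      have : 1 ≤ N x / (ε / 2) - 1 := by
        rw [le_sub_iff_add_le, le_div_iff₀ (by linarith)]
        linarith [hεN x hx]
      simp only [t, min_eq_left this, max_eq_right zero_le_one]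
    funext k
    rcases k with i | i <;> simp [g, f, ht1]

end

/-! ### The lower bound -/

/-- If the covering dimension is at least `2 j`, then the radius of comparison is at least
`j - 2`. -/
lemma le_radiusOfComparison {X : Type*} [TopologicalSpace X] [CompactSpace X] [T2Space X] {j : ℕ}
    (hX : ((2 * j : ℝ) : EReal) ≤ coveringDim X) :
    (((j : ℝ) - 2 : ℝ) : EReal) ≤ (radiusOfComparison C(X, ℂ) : EReal) := by
  have key : ∀ r : ℝ≥0, HasRComparison C(X, ℂ) r → (j : ℝ) - 2 ≤ r := by
    intro r hr
    by_contra! hlt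
    obtain ⟨n, rfl⟩ : ∃ n, j = n + 1 := Nat.exists_eq_succ_of_ne_zero <| by
      rintro rfl
      have := r.coe_nonneg
      norm_num at hlt
      linarith
    push_cast at hlt
    have hext := (hr.nonvanishingExtension (n := n) (by linarith)).hasOpenRefinements
    have hle := hX.trans (iInf₂_le _ hext)
    rw [EReal.coe_le_coe_iff] at hle
    simp only [Fintype.card_sum, Fintype.card_fin] at hle
    push_cast at hle
    linarith
  have hENN : ENNReal.ofReal ((j : ℝ) - 2) ≤ radiusOfComparison C(X, ℂ) :=
    le_iInf₂ fun r hr => ENNReal.ofReal_le_of_le_toReal (by simpa using key r hr)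
  refine le_trans ?_ (EReal.coe_ennreal_le_coe_ennreal_iff.mpr hENN)
  rw [EReal.coe_ennreal_ofReal, EReal.coe_le_coe_iff]
  exact le_max_left _ _

theorem mainTheorem2 (X : Type*) [TopologicalSpace X] [CompactSpace X] [T2Space X] :
    (coveringDim X = ⊤ → radiusOfComparison C(X, ℂ) = ⊤) ∧
    (∀ d : ℤ, coveringDim X = ((d : ℝ) : EReal) →
      (d ≡ 0 [ZMOD 4] →
        ((((d : ℝ) - 4) / 2 : ℝ) : EReal) ≤ (radiusOfComparison C(X, ℂ) : EReal)) ∧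
      (d ≡ 1 [ZMOD 4] →
        ((((d : ℝ) - 5) / 2 : ℝ) : EReal) ≤ (radiusOfComparison C(X, ℂ) : EReal)) ∧
      (d ≡ 2 [ZMOD 4] →
        ((((d : ℝ) - 6) / 2 : ℝ) : EReal) ≤ (radiusOfComparison C(X, ℂ) : EReal)) ∧
      (d ≡ 3 [ZMOD 4] →
        ((((d : ℝ) - 7) / 2 : ℝ) : EReal) ≤ (radiusOfComparison C(X, ℂ) : EReal))) := by
  refine ⟨fun hX => ?_, fun d hd => ?_⟩
  · refine ENNReal.eq_top_of_forall_nnreal_le fun r => ?_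
    obtain ⟨j, hj⟩ := exists_nat_ge ((r : ℝ) + 2)
    have h := le_radiusOfComparison (X := X) (j := j) (by rw [hX]; exact le_top)
    rw [← EReal.coe_ennreal_le_coe_ennreal_iff]
    refine le_trans ?_ h
    rw [EReal.coe_nnreal_eq_coe_real, EReal.coe_le_coe_iff]
    linarith
  · -- A negative bound is trivial, and otherwise `d - c = 2 (j - 2)` with `2 j ≤ d`.
    have hbound : ∀ c : ℤ, 4 ≤ c → Even (d - c) →
        ((((d : ℝ) - c) / 2 : ℝ) : EReal) ≤ (radiusOfComparison C(X, ℂ) : EReal) := by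
      rintro c hc ⟨m, hm⟩
      have hmR : ((d : ℝ) - c) / 2 = m := by
        have : (d : ℝ) - c = m + m := by exact_mod_cast hm
        linarith
      rw [hmR]
      rcases lt_or_ge m 0 with hneg | hnonneg
      · refine le_trans ?_ (EReal.coe_ennreal_nonneg _)
        exact_mod_cast hneg.le
      · lift m to ℕ using hnonneg
        have h := le_radiusOfComparison (X := X) (j := m + 2) <| by
          rw [hd, EReal.coe_le_coe_iff]
          have : 2 * ((m : ℤ) + 2) ≤ d := by omega
          exact_mod_cast this
        have hcast : ((m + 2 : ℕ) : ℝ) - 2 = ((m : ℤ) : ℝ) := by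
          push_cast
          ring
        rwa [hcast] at h
    refine ⟨fun h => ?_, fun h => ?_, fun h => ?_, fun h => ?_⟩ <;> rw [Int.ModEq] at h
    · exact_mod_cast hbound 4 (by norm_num) (by rw [Int.even_iff]; omega)
    · exact_mod_cast hbound 5 (by norm_num) (by rw [Int.even_iff]; omega)
    · exact_mod_cast hbound 6 (by norm_num) (by rw [Int.even_iff]; omega)
    · exact_mod_cast hbound 7 (by norm_num) (by rw [Int.even_iff]; omega)
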